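/- Let $X$ and $Y$ be Banach spaces over the same scalar field $\mathbb K=\mathbb R$ or $\mathbb C$. Suppose that the closed unit ball of $Y^*$ is weak$^*$-sequentially compact (every sequence in it has a subsequence that converges weak$^*$ to an element of it), and let $T:X\to Y$ be a bounded linear operator that is not weakly compact, i.e. the image under $T$ of the closed unit ball of $X$ is not relatively compact in the weak topology of $Y$. Then $T$ factors the summation operator $$\Sigma:\ell_1\to c,\qquad \Sigma\big((a_n)_{n=1}^\infty\big)=\Big(\sum_{i=1}^n a_i\Big)_{n=1}^\infty,$$ where $\ell_1$ is the space of absolutely summable sequences in $\mathbb K$ and $c$ is the space of convergent sequences in $\mathbb K$ with the supremum norm; that is, there exist bounded linear operators $U:\ell_1\to X$ and $V:Y\to c$ such that $VTU=\Sigma$. -/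

import Mathlib

open Filter Topology
open scoped ENNReal

noncomputable section

/-- `T` factors `S` if `S = V T U` for some bounded linear operators `U` and `V`. -/
def Factors {𝕜 W X Y Z : Type*} [RCLike 𝕜]
    [NormedAddCommGroup W] [NormedSpace 𝕜 W] [NormedAddCommGroup X] [NormedSpace 𝕜 X]
    [NormedAddCommGroup Y] [NormedSpace 𝕜 Y] [NormedAddCommGroup Z] [NormedSpace 𝕜 Z]
    (T : X →L[𝕜] Y) (S : W →L[𝕜] Z) : Prop :=
  ∃ (U : W →L[𝕜] X) (V : Y →L[𝕜] Z), V.comp (T.comp U) = S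

/-- `T` is weakly compact if the image of the closed unit ball is relatively compact in the
weak topology of the codomain. -/
def IsWeaklyCompactOperator {𝕜 X Y : Type*} [RCLike 𝕜]
    [NormedAddCommGroup X] [NormedSpace 𝕜 X] [NormedAddCommGroup Y] [NormedSpace 𝕜 Y]
    (T : X →L[𝕜] Y) : Prop :=
  IsCompact (closure (toWeakSpace 𝕜 Y '' (T '' Metric.closedBall (0 : X) 1)))

/-- The closed unit ball of the dual of `Y` is weak*-sequentially compact. -/
def HasWeakStarSeqCompactDualBall (𝕜 Y : Type*) [RCLike 𝕜]
    [NormedAddCommGroup Y] [NormedSpace 𝕜 Y] : Prop :=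
  IsSeqCompact {f : WeakDual 𝕜 Y | ‖WeakDual.toStrongDual f‖ ≤ 1}

/-- The Banach space `ℓ₁` of absolutely summable sequences of scalars. -/
abbrev EllOne (𝕜 : Type*) [RCLike 𝕜] := lp (fun _ : ℕ => 𝕜) 1

/-- The Banach space `c` of convergent sequences of scalars with the supremum norm, as a
subspace of `ℓ_∞`. -/
def ConvSeq (𝕜 : Type*) [RCLike 𝕜] : Submodule 𝕜 (lp (fun _ : ℕ => 𝕜) ∞) where
  carrier := {x | ∃ l : 𝕜, Tendsto (fun n => x n) atTop (𝓝 l)}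
  zero_mem' := ⟨0, by simp⟩
  add_mem' := by
    rintro x y ⟨l, hl⟩ ⟨m, hm⟩
    exact ⟨l + m, by simpa using hl.add hm⟩
  smul_mem' := by
    rintro a x ⟨l, hl⟩
    exact ⟨a * l, by simpa using hl.const_mul a⟩

theorem EllOne.summable_norm {𝕜 : Type*} [RCLike 𝕜] (a : EllOne 𝕜) :
    Summable (fun n => ‖a n‖) := by
  simpa using (lp.memℓp a).summable (by simp)

theorem EllOne.norm_eq {𝕜 : Type*} [RCLike 𝕜] (a : EllOne 𝕜) : ‖a‖ = ∑' n, ‖a n‖ := by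
  simpa using lp.norm_eq_tsum_rpow (p := 1) (by simp) a

theorem EllOne.norm_partialSum_le {𝕜 : Type*} [RCLike 𝕜] (a : EllOne 𝕜) (n : ℕ) :
    ‖∑ i ∈ Finset.range (n + 1), a i‖ ≤ ‖a‖ := by
  rw [EllOne.norm_eq]
  exact (norm_sum_le _ _).trans
    ((EllOne.summable_norm a).sum_le_tsum _ (fun _ _ => norm_nonneg _))

/-- The sequence of partial sums of an element of `ℓ₁`, as an element of `c`. Sequences are
indexed from `0`, so its `n`-th entry is `a 0 + ⋯ + a n`. -/
def partialSums {𝕜 : Type*} [RCLike 𝕜] (a : EllOne 𝕜) : ConvSeq 𝕜 :=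
  ⟨⟨fun n => ∑ i ∈ Finset.range (n + 1), a i,
    memℓp_infty ⟨‖a‖, by rintro _ ⟨n, rfl⟩; exact EllOne.norm_partialSum_le a n⟩⟩,
   ⟨∑' i, a i, (tendsto_add_atTop_iff_nat 1).2
      (EllOne.summable_norm a).of_norm.hasSum.tendsto_sum_nat⟩⟩

/-- The summation operator `(aₙ) ↦ (∑_{i ≤ n} aᵢ)` from `ℓ₁` to `c`. -/
def summationOperator (𝕜 : Type*) [RCLike 𝕜] : EllOne 𝕜 →L[𝕜] ConvSeq 𝕜 :=
  LinearMap.mkContinuous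
    { toFun := partialSums
      map_add' := fun a b => by
        ext n
        exact Finset.sum_add_distrib (s := Finset.range (n + 1)) (f := fun i => a i) (g := fun i => b i)
      map_smul' := fun r a => by
        ext n
        exact (Finset.mul_sum (Finset.range (n + 1)) (fun i => a i) r).symm }
    1 (fun a => by
      rw [one_mul]
      exact lp.norm_le_of_forall_le (norm_nonneg a) (EllOne.norm_partialSum_le a))

theorem summationOperator_apply {𝕜 : Type*} [RCLike 𝕜] (a : EllOne 𝕜) (n : ℕ) :
    (summationOperator 𝕜 a : lp (fun _ : ℕ => 𝕜) ∞) n = ∑ i ∈ Finset.range (n + 1), a i :=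
  rfl

end

/-! Some `φ = T**ξ` with `‖ξ‖ ≤ 1` lies outside `Y`. As `Y` is closed in its bidual, for every
finite subset of `Y` there is a functional `g`, with a uniform norm bound, that kills the subset and
has `φ g = 1`. Helly's lemma supplies `x` with `‖x‖ ≤ 2` on which `T x` imitates `φ` at finitely
many functionals. Alternating the two choices gives `g m (T (x n)) = 1` for `m ≤ n` and `0`
otherwise. With `U e_n = x n`, the functional `g m` reads off the tail of `a` from `m` on, so
differences of the `g m` read off partial sums. Weak* sequential compactness is needed only to pass
to a subsequence along which these differences converge pointwise, so that `V` lands in `c`. -/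

/-- **Helly's lemma**: finitely many values of a bidual element are attained by a vector whose norm
is only slightly larger. -/
theorem exists_forall_apply_eq_of_bidual {𝕜 X ι : Type*} [RCLike 𝕜] [Fintype ι]
    [NormedAddCommGroup X] [NormedSpace 𝕜 X] [CompleteSpace X]
    (ξ : StrongDual 𝕜 (StrongDual 𝕜 X)) (f : ι → StrongDual 𝕜 X) {ε : ℝ} (hε : 0 < ε) :
    ∃ x : X, ‖x‖ ≤ ‖ξ‖ + ε ∧ ∀ i, f i x = ξ (f i) := by
  classical
  let _ : NormedSpace ℝ X := NormedSpace.restrictScalars ℝ 𝕜 X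
  set F : X →L[𝕜] (ι → 𝕜) := ContinuousLinearMap.pi f with hF
  set v : ι → 𝕜 := fun i => ξ (f i) with hv
  set C : Set (ι → 𝕜) := F '' Metric.closedBall 0 ‖ξ‖
  have hconv : Convex ℝ C :=
    (convex_closedBall (0 : X) ‖ξ‖).is_linear_image (f := F)
      ⟨F.map_add, fun r x => by
        have : r • x = (r : 𝕜) • x := (RCLike.real_smul_eq_coe_smul (K := 𝕜) r x)
        rw [this, map_smul, RCLike.real_smul_eq_coe_smul (K := 𝕜)]⟩
  -- Approximate solutions by separation
  have hmem : v ∈ closure C := by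
    by_contra hvC
    obtain ⟨l, u, hlC, hlv⟩ := RCLike.geometric_hahn_banach_closed_point (𝕜 := 𝕜)
      hconv.closure isClosed_closure hvC
    -- `l.comp F` is a combination of the `f i`, so `ξ` can be evaluated on it. Separation would
    -- force `‖l.comp F‖ * ‖ξ‖ ≤ u < re (ξ (l.comp F))`.
    have hξ : ξ (l.comp F) = l v := by
      have hsum (w : ι → 𝕜) : l w = ∑ i, w i * l (Pi.single i 1) := by
        conv_lhs => rw [← Finset.univ_sum_single w, map_sum]
        refine Finset.sum_congr rfl fun i _ => ?_
        rw [← smul_eq_mul, ← map_smul, ← Pi.single_smul, smul_eq_mul, mul_one]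
      have : l.comp F = ∑ i, l (Pi.single i 1) • f i := by
        ext x
        rw [ContinuousLinearMap.comp_apply, hsum (F x)]
        simp [hF, mul_comm]
      rw [this, map_sum, hsum v]
      simp [hv, mul_comm]
    have hu : 0 < u := by
      simpa using hlC 0 (subset_closure ⟨0, Metric.mem_closedBall_self (norm_nonneg ξ), map_zero F⟩)
    have hball : ∀ x ∈ Metric.ball (0 : X) 1, ‖(l.comp F) x‖ * ‖ξ‖ ≤ u := by
      intro x hx
      obtain ⟨c, hc, hcx⟩ : ∃ c : 𝕜, ‖c‖ ≤ 1 ∧ c * l (F x) = (‖l (F x)‖ : 𝕜) := by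
        obtain ⟨c, hc, h⟩ := RCLike.exists_norm_eq_mul_self (l (F x))
        exact ⟨c, hc.le, h.symm⟩
      have := hlC (F (((‖ξ‖ : 𝕜) * c) • x)) (subset_closure ⟨_, by
        rw [mem_closedBall_zero_iff, norm_smul, norm_mul, RCLike.norm_ofReal,
          abs_of_nonneg (norm_nonneg ξ), mul_assoc]
        have hx' : ‖x‖ ≤ 1 := (mem_ball_zero_iff.1 hx).le
        exact mul_le_of_le_one_right (norm_nonneg _) (mul_le_one₀ hc (norm_nonneg _) hx'), rfl⟩)
      rw [map_smul, map_smul, smul_eq_mul, mul_assoc, hcx, ← RCLike.ofReal_mul,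
        RCLike.ofReal_re] at this
      rw [mul_comm]
      exact this.le
    have hnorm : ‖l.comp F‖ * ‖ξ‖ ≤ u := by
      rcases (norm_nonneg ξ).eq_or_lt with h0 | h0
      · rw [← h0, mul_zero]; exact hu.le
      · rw [← le_div_iff₀ h0]
        rw [← ContinuousLinearMap.sSup_unit_ball_eq_norm]
        refine csSup_le ((Metric.nonempty_ball.2 one_pos).image _) ?_
        rintro _ ⟨x, hx, rfl⟩
        exact (le_div_iff₀ h0).2 (hball x hx)
    have h1 : RCLike.re (l v) ≤ ‖ξ‖ * ‖l.comp F‖ := by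
      rw [← hξ]
      exact (RCLike.re_le_norm _).trans (ξ.le_opNorm _)
    linarith [mul_comm ‖ξ‖ ‖l.comp F‖]
  have hrange : v ∈ LinearMap.range (F : X →ₗ[𝕜] (ι → 𝕜)) := by
    have hcl := (LinearMap.range (F : X →ₗ[𝕜] (ι → 𝕜))).closed_of_finiteDimensional
    refine hcl.closure_subset_iff.2 ?_ hmem
    rintro _ ⟨x, -, rfl⟩
    exact ⟨x, rfl⟩
  set R := LinearMap.range (F : X →ₗ[𝕜] (ι → 𝕜))
  let G : X →L[𝕜] R := F.codRestrict R fun x => ⟨x, rfl⟩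
  obtain ⟨K, hK, hG⟩ := ContinuousLinearMap.exists_preimage_norm_le G (by
    rintro ⟨_, x, rfl⟩
    exact ⟨x, rfl⟩)
  -- By the open mapping constant `K`, an error below `ε / K` is corrected exactly by a vector of
  -- norm at most `ε`.
  obtain ⟨_, ⟨x, hx, rfl⟩, hdist⟩ := Metric.mem_closure_iff.1 hmem (ε / K) (by positivity)
  obtain ⟨z, hz, hzn⟩ := hG (⟨v, hrange⟩ - G x)
  refine ⟨x + z, (norm_add_le _ _).trans (add_le_add (mem_closedBall_zero_iff.1 hx) ?_), ?_⟩
  · refine hzn.trans ?_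
    have : ‖(⟨v, hrange⟩ - G x : R)‖ = dist v (F x) := by rw [dist_eq_norm]; rfl
    rw [this, mul_comm, ← le_div_iff₀ hK]
    exact hdist.le
  · intro i
    have := congrFun (congrArg Subtype.val hz) i
    have h2 : f i z = ξ (f i) - f i x := this
    rw [map_add, h2, add_sub_cancel]

open NormedSpace in
/-- A bidual element outside a complete space is bounded below, uniformly, on the annihilators of
finite sets. -/
theorem exists_bound_annihilator_of_notMem_range {𝕜 Y : Type*} [RCLike 𝕜]
    [NormedAddCommGroup Y] [NormedSpace 𝕜 Y] [CompleteSpace Y]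
    (φ : StrongDual 𝕜 (StrongDual 𝕜 Y)) (hφ : φ ∉ Set.range (inclusionInDoubleDual 𝕜 Y)) :
    ∃ K : ℝ, 0 < K ∧ ∀ s : Finset Y, ∃ g : StrongDual 𝕜 Y,
      ‖g‖ ≤ K ∧ φ g = 1 ∧ ∀ y ∈ s, g y = 0 := by
  have hclosed : IsClosed (Set.range (inclusionInDoubleDual 𝕜 Y)) :=
    by
    have : Isometry (inclusionInDoubleDual 𝕜 Y) := (inclusionInDoubleDualLi 𝕜 (E := Y)).isometry
    exact this.isClosedEmbedding.isClosed_range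
  obtain ⟨δ, hδ, hball⟩ := Metric.isOpen_iff.1 hclosed.isOpen_compl φ hφ
  refine ⟨2 / δ, by positivity, fun s => ?_⟩
  let J : s → StrongDual 𝕜 Y →ₗ[𝕜] 𝕜 := fun y => (inclusionInDoubleDual 𝕜 Y y).toLinearMap
  let A : Submodule 𝕜 (StrongDual 𝕜 Y) := ⨅ y, LinearMap.ker (J y)
  have hA {g : StrongDual 𝕜 Y} : g ∈ A ↔ ∀ y ∈ s, g y = 0 := by
    simp [A, J, Submodule.mem_iInf]
  -- Otherwise a Hahn–Banach extension `ψ` of `φ` restricted to `A` has norm at most `δ / 2`; then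
  -- `φ - ψ` vanishes on `A`, so it is evaluation at a vector in the span of `s`, yet within `δ` of
  -- `φ`.
  obtain ⟨g, hgA, hg⟩ : ∃ g ∈ A, δ / 2 * ‖g‖ < ‖φ g‖ := by
    by_contra! hle
    obtain ⟨ψ, hψ, hψn⟩ := exists_extension_norm_eq A (φ.comp A.subtypeL)
    have hn : ‖ψ‖ ≤ δ / 2 := by
      rw [hψn]
      exact ContinuousLinearMap.opNorm_le_bound _ (by positivity) fun g => hle g g.2
    have hspan := mem_span_of_iInf_ker_le_ker (L := J) (K := (φ - ψ).toLinearMap) fun g hg => by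
      have := hψ ⟨g, hg⟩
      simp only [ContinuousLinearMap.comp_apply, Submodule.subtypeL_apply] at this
      simp [this]
    obtain ⟨c, hc⟩ := (Submodule.mem_span_range_iff_exists_fun 𝕜).1 hspan
    refine @hball (φ - ψ) ?_ ⟨∑ y, c y • (y : Y), ?_⟩
    · have h1 : φ - ψ - φ = -ψ := by
        ext g
        simp
      have h2 : dist (φ - ψ) φ = ‖φ - ψ - φ‖ := dist_eq_norm (φ - ψ) φ
      have h3 : ‖-ψ‖ = ‖ψ‖ := norm_neg ψ
      rw [Metric.mem_ball, h2, h1, h3]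
      linarith
    · ext g
      have := LinearMap.congr_fun hc g
      simpa [J] using this
  have hpos : 0 < ‖φ g‖ := (by positivity : 0 ≤ δ / 2 * ‖g‖).trans_lt hg
  refine ⟨(φ g)⁻¹ • g, ?_, ?_, fun y hy => by simp [hA.1 hgA y hy]⟩
  · rw [norm_smul, norm_inv, inv_mul_eq_div, div_le_div_iff₀ hpos hδ]
    linarith
  · simp [norm_pos_iff.1 hpos]

open NormedSpace in
/-- If `T` is not weakly compact then its second adjoint maps some element outside `Y`. -/
theorem exists_bidual_notMem_range_of_not_isWeaklyCompactOperator {𝕜 X Y : Type*} [RCLike 𝕜]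
    [NormedAddCommGroup X] [NormedSpace 𝕜 X] [NormedAddCommGroup Y] [NormedSpace 𝕜 Y]
    (T : X →L[𝕜] Y) (hT : ¬ IsWeaklyCompactOperator T) :
    ∃ ξ : StrongDual 𝕜 (StrongDual 𝕜 X), ‖ξ‖ ≤ 1 ∧
      ξ.comp (ContinuousLinearMap.precomp 𝕜 T) ∉ Set.range (inclusionInDoubleDual 𝕜 Y) := by
  by_contra! h
  refine hT (isCompact_closure_of_isBounded 𝕜 Y _ ?_ ?_)
  · rw [Set.preimage_image_eq _ (toWeakSpace 𝕜 Y).injective]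
    exact T.lipschitz.isBounded_image Metric.isBounded_closedBall
  -- `D` is `T**`, weak*-continuous, so it maps the bidual ball (Banach–Alaoglu) to a weak*-compact
  -- set containing the image of the unit ball of `X`. That set is closed and, by `h`, lies in `Y`.
  let D : WeakDual 𝕜 (StrongDual 𝕜 X) → WeakDual 𝕜 (StrongDual 𝕜 Y) := fun ξ =>
    StrongDual.toWeakDual ((WeakDual.toStrongDual ξ).comp (ContinuousLinearMap.precomp 𝕜 T))
  have hD : Continuous D :=
    WeakDual.continuous_of_continuous_eval fun g =>
      WeakDual.eval_continuous (ContinuousLinearMap.precomp 𝕜 T g)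
  have hcomp := (WeakDual.isCompact_closedBall (𝕜 := 𝕜) (E := StrongDual 𝕜 X) 0 1).image hD
  refine (closure_minimal ?_ hcomp.isClosed).trans ?_
  · rintro _ ⟨_, ⟨_, ⟨x, hx, rfl⟩, rfl⟩, rfl⟩
    refine ⟨StrongDual.toWeakDual (inclusionInDoubleDual 𝕜 X x), ?_, rfl⟩
    have := (double_dual_bound 𝕜 X x).trans (mem_closedBall_zero_iff.1 hx)
    exact mem_closedBall_zero_iff.2 this
  · rintro _ ⟨ξ, hξ, rfl⟩
    obtain ⟨y, hy⟩ := h (WeakDual.toStrongDual ξ) (mem_closedBall_zero_iff.1 hξ)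
    exact ⟨toWeakSpace 𝕜 Y y, congrArg StrongDual.toWeakDual hy⟩

/-- An operator that is not weakly compact admits a bounded triangular system. -/
theorem exists_triangular_system_of_not_isWeaklyCompactOperator {𝕜 X Y : Type*} [RCLike 𝕜]
    [NormedAddCommGroup X] [NormedSpace 𝕜 X] [CompleteSpace X]
    [NormedAddCommGroup Y] [NormedSpace 𝕜 Y] [CompleteSpace Y]
    (T : X →L[𝕜] Y) (hT : ¬ IsWeaklyCompactOperator T) :
    ∃ (K : ℝ) (x : ℕ → X) (g : ℕ → StrongDual 𝕜 Y), 0 < K ∧ (∀ n, ‖x n‖ ≤ 2) ∧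
      (∀ n, ‖g n‖ ≤ K) ∧ ∀ m n, g m (T (x n)) = if m ≤ n then 1 else 0 := by
  classical
  obtain ⟨ξ, hξ, hφ⟩ := exists_bidual_notMem_range_of_not_isWeaklyCompactOperator T hT
  set φ : StrongDual 𝕜 (StrongDual 𝕜 Y) := ξ.comp (ContinuousLinearMap.precomp 𝕜 T)
  obtain ⟨K, hK, hg⟩ := exists_bound_annihilator_of_notMem_range φ hφ
  -- The new `g` kills all earlier `T p.1`; only then is `x` chosen, matching `φ` on the earlier
  -- functionals and on `g` itself.
  obtain ⟨p, hP, hr⟩ := exists_seq_of_forall_finset_exists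
    (fun p : X × StrongDual 𝕜 Y => ‖p.1‖ ≤ 2 ∧ ‖p.2‖ ≤ K ∧ φ p.2 = 1 ∧ p.2 (T p.1) = 1)
    (fun p q => p.2 (T q.1) = 1 ∧ q.2 (T p.1) = 0) fun s hs => by
      obtain ⟨g, hgK, hg1, hg0⟩ := hg (s.image fun p => T p.1)
      let t : Finset (StrongDual 𝕜 Y) := insert g (s.image Prod.snd)
      obtain ⟨x, hx, hxt⟩ := exists_forall_apply_eq_of_bidual ξ
        (fun f : t => (f : StrongDual 𝕜 Y).comp T) one_pos
      have ht : ∀ f ∈ t, f (T x) = φ f := fun f hf => hxt ⟨f, hf⟩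
      refine ⟨(x, g), ⟨by linarith, hgK, hg1, ?_⟩, fun q hq => ⟨?_, ?_⟩⟩
      · exact (ht g (Finset.mem_insert_self _ _)).trans hg1
      · exact (ht q.2 (Finset.mem_insert_of_mem (Finset.mem_image_of_mem _ hq))).trans (hs q hq).2.2.1
      · exact hg0 _ (Finset.mem_image_of_mem (fun p : X × StrongDual 𝕜 Y => T p.1) hq)
  refine ⟨K, fun n => (p n).1, fun n => (p n).2, hK, fun n => (hP n).1, fun n => (hP n).2.1,
    fun m n => ?_⟩
  rcases lt_trichotomy m n with h | rfl | h
  · rw [if_pos h.le]; exact (hr m n h).1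
  · rw [if_pos le_rfl]; exact (hP m).2.2.2
  · rw [if_neg h.not_ge]; exact (hr n m h).2

/-- Under weak* sequential compactness of the dual ball, every bounded sequence of functionals has a
pointwise convergent subsequence. -/
theorem HasWeakStarSeqCompactDualBall.exists_subseq_tendsto {𝕜 Y : Type*} [RCLike 𝕜]
    [NormedAddCommGroup Y] [NormedSpace 𝕜 Y] (hY : HasWeakStarSeqCompactDualBall 𝕜 Y)
    {K : ℝ} (hK : 0 < K) (g : ℕ → StrongDual 𝕜 Y) (hg : ∀ n, ‖g n‖ ≤ K) :
    ∃ (s : ℕ → ℕ) (h : StrongDual 𝕜 Y), StrictMono s ∧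
      ∀ y, Tendsto (fun n => g (s n) y) atTop (𝓝 (h y)) := by
  have hK' : (K : 𝕜) ≠ 0 := RCLike.ofReal_ne_zero.2 hK.ne'
  obtain ⟨a, -, s, hs, ha⟩ := hY (x := fun n => StrongDual.toWeakDual ((K : 𝕜)⁻¹ • g n)) fun n => by
    have : ‖(K : 𝕜)⁻¹ • g n‖ ≤ 1 := by
      rw [norm_smul, norm_inv, RCLike.norm_ofReal, abs_of_pos hK, inv_mul_le_iff₀ hK, mul_one]
      exact hg n
    exact this
  refine ⟨s, (K : 𝕜) • WeakDual.toStrongDual a, hs, fun y => ?_⟩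
  have h1 : Tendsto (fun n => (K : 𝕜)⁻¹ * g (s n) y) atTop (𝓝 (a y)) :=
    ((WeakDual.eval_continuous y).tendsto a).comp ha
  simpa [hK'] using h1.const_mul (K : 𝕜)

/-- The operator from `ℓ₁` sending the unit vectors to a given bounded sequence. -/
noncomputable def EllOne.lift {𝕜 X : Type*} [RCLike 𝕜] [NormedAddCommGroup X] [NormedSpace 𝕜 X]
    [CompleteSpace X] (x : ℕ → X) (C : ℝ) (hx : ∀ n, ‖x n‖ ≤ C) : EllOne 𝕜 →L[𝕜] X :=
  have hle (a : EllOne 𝕜) (n : ℕ) : ‖a n • x n‖ ≤ ‖a n‖ * C := by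
    rw [norm_smul]
    exact mul_le_mul_of_nonneg_left (hx n) (norm_nonneg _)
  have hsum (a : EllOne 𝕜) : Summable fun n => a n • x n :=
    .of_norm_bounded ((EllOne.summable_norm a).mul_right C) (hle a)
  LinearMap.mkContinuous
    { toFun := fun a => ∑' n, a n • x n
      map_add' := fun a b => by
        rw [← (hsum a).tsum_add (hsum b)]
        exact tsum_congr fun n => add_smul (a n) (b n) (x n)
      map_smul' := fun r a => by
        rw [RingHom.id_apply, ← (hsum a).tsum_const_smul r]
        exact tsum_congr fun n => mul_smul r (a n) (x n) }
    C (fun a => by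
      rw [EllOne.norm_eq, mul_comm, ← tsum_mul_right]
      exact tsum_of_norm_bounded ((EllOne.summable_norm a).mul_right C).hasSum (hle a))

theorem EllOne.hasSum_lift {𝕜 X : Type*} [RCLike 𝕜] [NormedAddCommGroup X] [NormedSpace 𝕜 X]
    [CompleteSpace X] (x : ℕ → X) (C : ℝ) (hx : ∀ n, ‖x n‖ ≤ C) (a : EllOne 𝕜) :
    HasSum (fun n => a n • x n) (EllOne.lift x C hx a) := by
  refine Summable.hasSum (.of_norm_bounded ((EllOne.summable_norm a).mul_right C) fun n => ?_)
  rw [norm_smul]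
  exact mul_le_mul_of_nonneg_left (hx n) (norm_nonneg _)

/-- The operator into `c` given by a bounded, pointwise convergent sequence of functionals. -/
noncomputable def ConvSeq.lift {𝕜 Y : Type*} [RCLike 𝕜] [NormedAddCommGroup Y] [NormedSpace 𝕜 Y]
    (g : ℕ → StrongDual 𝕜 Y) (C : ℝ) (hg : ∀ n, ‖g n‖ ≤ C)
    (hlim : ∀ y, ∃ l, Tendsto (fun n => g n y) atTop (𝓝 l)) : Y →L[𝕜] ConvSeq 𝕜 :=
  have hle (y : Y) (n : ℕ) : ‖g n y‖ ≤ C * ‖y‖ := (g n).le_of_opNorm_le (hg n) y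
  LinearMap.mkContinuous
    { toFun := fun y => ⟨⟨fun n => g n y,
        memℓp_infty ⟨C * ‖y‖, by rintro _ ⟨n, rfl⟩; exact hle y n⟩⟩, hlim y⟩
      map_add' := fun y z => by
        ext n
        exact map_add (g n) y z
      map_smul' := fun r y => by
        ext n
        exact map_smul (g n) r y }
    C (fun y => lp.norm_le_of_forall_le
      (mul_nonneg ((norm_nonneg _).trans (hg 0)) (norm_nonneg y)) (hle y))

theorem ConvSeq.lift_apply {𝕜 Y : Type*} [RCLike 𝕜] [NormedAddCommGroup Y] [NormedSpace 𝕜 Y]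
    (g : ℕ → StrongDual 𝕜 Y) (C : ℝ) (hg : ∀ n, ‖g n‖ ≤ C)
    (hlim : ∀ y, ∃ l, Tendsto (fun n => g n y) atTop (𝓝 l)) (y : Y) (n : ℕ) :
    (ConvSeq.lift g C hg hlim y : lp (fun _ : ℕ => 𝕜) ∞) n = g n y :=
  rfl

theorem mainTheorem10 {𝕜 X Y : Type*} [RCLike 𝕜]
    [NormedAddCommGroup X] [NormedSpace 𝕜 X] [CompleteSpace X]
    [NormedAddCommGroup Y] [NormedSpace 𝕜 Y] [CompleteSpace Y]
    (hY : HasWeakStarSeqCompactDualBall 𝕜 Y)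
    (T : X →L[𝕜] Y) (hT : ¬ IsWeaklyCompactOperator T) :
    Factors T (summationOperator 𝕜) := by
  obtain ⟨K, x, g, hK, hx, hg, hxg⟩ := exists_triangular_system_of_not_isWeaklyCompactOperator T hT
  obtain ⟨s, h, hs, hlim⟩ := hY.exists_subseq_tendsto hK g hg
  -- The tail from `0` minus the tail from `m + 1`: the shift keeps exactly the indices `n ≤ m`.
  -- Passing to `s` on both sides preserves the triangular pattern.
  let G : ℕ → StrongDual 𝕜 Y := fun n => g (s 0) - g (s (n + 1))
  refine ⟨EllOne.lift (fun n => x (s n)) 2 (fun n => hx _),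
    ConvSeq.lift G (K + K) (fun n => (norm_sub_le _ _).trans (add_le_add (hg _) (hg _)))
      (fun y => ⟨g (s 0) y - h y, ((tendsto_add_atTop_iff_nat 1).2 (hlim y)).const_sub _⟩), ?_⟩
  ext a m
  rw [summationOperator_apply, ContinuousLinearMap.comp_apply, ConvSeq.lift_apply,
    ContinuousLinearMap.comp_apply]
  have hsum := (EllOne.hasSum_lift (fun n => x (s n)) 2 (fun n => hx _) a).mapL ((G m).comp T)
  have hG (n : ℕ) : G m (T (x (s n))) = if n ∈ Finset.range (m + 1) then 1 else 0 := by
    simp only [G, sub_apply, hxg, hs.le_iff_le, Finset.mem_range]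
    by_cases hn : n < m + 1
    · simp [hn, hn.not_ge]
    · simp [hn, not_lt.1 hn]
  have hterm (n : ℕ) : ((G m).comp T) (a n • x (s n)) =
      if n ∈ Finset.range (m + 1) then a n else 0 := by
    rw [map_smul, ContinuousLinearMap.comp_apply, hG]
    simp
  simp only [hterm] at hsum
  refine hsum.unique ?_
  rw [← Finset.sum_congr rfl fun n hn => if_pos hn]
  exact hasSum_sum_of_ne_finset_zero fun n hn => if_neg hn
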